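/- Let $p$ be a prime and let $G$ be a residually finite group with profinite completion $\widehat G$. Assume that $G$ is cohomologically good, i.e. the natural map $G\to\widehat G$ induces isomorphisms $H^n(\widehat G,M)\to H^n(G,M)$ for every $n\ge 0$ and every finite discrete $\widehat G$-module $M$, where $H^n(\widehat G,M)$ denotes continuous cohomology (equivalently, for every finite $G$-module $M$, since the $G$-action on such an $M$ extends uniquely to a continuous action of $\widehat G$). Assume also that $\mathrm{vcd}(G)<\infty$, i.e. $G$ has a torsion-free subgroup of finite index whose cohomological dimension is finite. Then $G$ has finitely many conjugacy classes of subgroups of order $p$ if and only if it has finitely many conjugacy classes of elements of order $p$; and if this is the case, then every element of order $p$ in $\widehat G$ is conjugate in $\widehat G$ to (the image of) some element of $G$. -/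

import Mathlib

open CategoryTheory

universe u

noncomputable section

/-- The ring of integers, in the universe of the groups under consideration: `Rep IntU G` is the
category of `G`-modules (abelian groups with a linear action of `G`). -/
def IntU : Type u := ULift.{u} ℤ

instance : CommRing IntU.{u} := inferInstanceAs (CommRing (ULift.{u} ℤ))

/-- The profinite completion of an abstract group, the inverse limit of its finite quotients. -/
abbrev ProfComp (G : Type u) [Group G] : Type u :=
  ProfiniteGrp.ProfiniteCompletion.completion (GrpCat.of G)

/-- The canonical homomorphism of a group to its profinite completion. -/
def toProfComp (G : Type u) [Group G] : G →* ProfComp G :=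
  (ProfiniteGrp.ProfiniteCompletion.eta (GrpCat.of G)).hom

section ContinuousCochains

variable {k Γ : Type u} [CommRing k] [Group Γ] [TopologicalSpace Γ]

/-- A `k`-linear `Γ`-module `A` is a discrete `Γ`-module if the action `Γ × A → A` is continuous for the
discrete topology on `A`; equivalently, all orbit maps `g ↦ g • a` are locally constant. -/
def IsDiscreteModule (A : Rep.{u} k Γ) : Prop :=
  ∀ a : A, IsLocallyConstant fun g : Γ => A.ρ g a

/-- The cochains `Γⁿ → A` that are continuous for the discrete topology on `A`. -/
def contCochains (A : Rep.{u} k Γ) (n : ℕ) : Submodule k ((Fin n → Γ) → A) where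
  carrier := {f | IsLocallyConstant f}
  add_mem' hf hg := hf.add hg
  zero_mem' := IsLocallyConstant.const 0
  smul_mem' c _ hf := hf.comp (c • ·)

theorem continuous_contractNth [IsTopologicalGroup Γ] {n : ℕ} (j : Fin (n + 1)) :
    Continuous fun g : Fin (n + 1) → Γ => Fin.contractNth j (· * ·) g := by
  refine continuous_pi fun i => ?_
  unfold Fin.contractNth
  split_ifs <;> fun_prop

theorem d_mem_contCochains [IsTopologicalGroup Γ] (A : Rep.{u} k Γ)
    (hA : IsDiscreteModule A) (n : ℕ) (f : (Fin n → Γ) → A) (hf : f ∈ contCochains A n) :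
    (inhomogeneousCochains.d A n).hom f ∈ contCochains A (n + 1) := by
  have hf' : IsLocallyConstant f := hf
  have h1 : IsLocallyConstant fun g : Fin (n + 1) → Γ => A.ρ (g 0) (f fun i => g i.succ) := by
    rw [IsLocallyConstant.iff_eventually_eq]
    intro x
    have ha : IsLocallyConstant fun g : Fin (n + 1) → Γ => f fun i => g i.succ :=
      hf'.comp_continuous (by fun_prop)
    have hb : IsLocallyConstant fun g : Fin (n + 1) → Γ => A.ρ (g 0) (f fun i => x i.succ) :=
      (hA (f fun i => x i.succ)).comp_continuous (by fun_prop)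
    filter_upwards [ha.eventually_eq x, hb.eventually_eq x] with y h h'
    rw [h, h']
  have h2 : ∀ j : Fin (n + 1), (fun g : Fin (n + 1) → Γ =>
      (-1 : k) ^ ((j : ℕ) + 1) • f (Fin.contractNth j (· * ·) g)) ∈
        contCochains A (n + 1) := fun j =>
    (hf'.comp_continuous (continuous_contractNth j)).comp
      ((-1 : k) ^ ((j : ℕ) + 1) • ·)
  have h3 := Submodule.sum_mem _ fun (j : Fin (n + 1)) (_ : j ∈ Finset.univ) => h2 j
  have h4 := (contCochains A (n + 1)).add_mem h1 h3
  convert h4 using 1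
  ext g
  simp [inhomogeneousCochains.d_hom_apply]

variable [IsTopologicalGroup Γ]

/-- The differential of inhomogeneous cochains, restricted to continuous cochains. -/
def contCochainsD (A : Rep.{u} k Γ) (hA : IsDiscreteModule A) (n : ℕ) :
    ModuleCat.of k (contCochains A n) ⟶ ModuleCat.of k (contCochains A (n + 1)) :=
  ModuleCat.ofHom ((inhomogeneousCochains.d A n).hom.restrict (d_mem_contCochains A hA n))

theorem contCochainsD_comp (A : Rep.{u} k Γ) (hA : IsDiscreteModule A) (n : ℕ) :
    contCochainsD A hA n ≫ contCochainsD A hA (n + 1) = 0 := by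
  refine ModuleCat.hom_ext (LinearMap.ext fun f => Subtype.ext ?_)
  exact congrArg (fun φ => φ.hom f.1) (groupCohomology.inhomogeneousCochains.d_comp_d n A)

/-- The complex of continuous inhomogeneous cochains of a topological group `Γ` with values in
a discrete `Γ`-module `A`. -/
def contCochainComplex (A : Rep.{u} k Γ) (hA : IsDiscreteModule A) :
    CochainComplex (ModuleCat.{u} k) ℕ :=
  CochainComplex.of (fun n => ModuleCat.of k (contCochains A n))
    (contCochainsD A hA) (contCochainsD_comp A hA)

/-- The continuous cohomology group `Hⁿ(Γ, A)` of a discrete `Γ`-module `A`. -/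
def contCohomology (A : Rep.{u} k Γ) (hA : IsDiscreteModule A) (n : ℕ) :
    ModuleCat.{u} k :=
  (contCochainComplex A hA).homology n

/-- The inclusion of the complex of continuous cochains in that of all cochains. -/
def contCochainsIncl (A : Rep.{u} k Γ) (hA : IsDiscreteModule A) :
    contCochainComplex A hA ⟶ groupCohomology.inhomogeneousCochains A where
  f n := ModuleCat.ofHom (contCochains A n).subtype
  comm' i j hij := by
    obtain rfl : i + 1 = j := hij
    simp only [contCochainComplex, CochainComplex.of_d]
    rfl

/-- The map `Hⁿ(Γ, A) → Hⁿ(G, A)` induced by a homomorphism `φ : G → Γ` of an abstract group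
to a topological group: a continuous cocycle `c` is sent to `c ∘ φⁿ`. -/
def contCohomologyRes {G : Type u} [Group G] (φ : G →* Γ) (A : Rep.{u} k Γ)
    (hA : IsDiscreteModule A) (n : ℕ) :
    contCohomology A hA n ⟶ groupCohomology (Rep.res φ A) n :=
  HomologicalComplex.homologyMap
    (contCochainsIncl A hA ≫ groupCohomology.cochainsMap φ (𝟙 (Rep.res φ A))) n

end ContinuousCochains

/-- A group `G` is cohomologically good if the canonical map to its profinite completion `Ĝ`
induces isomorphisms `Hⁿ(Ĝ, M) ≅ Hⁿ(G, M)` for all `n` and all finite modules `M`.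
(Every action of `G` on a finite module extends uniquely to a continuous action of `Ĝ`.) -/
def IsCohomologicallyGood (G : Type u) [Group G] : Prop :=
  ∀ (M : Rep.{u} IntU.{u} (ProfComp G)) (hM : IsDiscreteModule M), Finite M →
    ∀ n : ℕ, IsIso (contCohomologyRes (toProfComp G) M hM n)

/-- The cohomological dimension of a group `G`: the projective dimension of the trivial
`G`-module `ℤ`. -/
def cohomDim (G : Type u) [Group G] : WithBot ℕ∞ :=
  projectiveDimension (Rep.trivial IntU.{u} G IntU.{u})

/-- The virtual cohomological dimension of a group: the cohomological dimension of its torsion-free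
subgroups of finite index, or `⊤` if there are none. (By a theorem of Serre these subgroups
all have the same cohomological dimension, so the infimum is their common value.) -/
def vcd (G : Type u) [Group G] : WithBot ℕ∞ :=
  ⨅ (H : Subgroup G) (_ : H.FiniteIndex) (_ : ∀ h : H, IsOfFinOrder h → h = 1), cohomDim H

open scoped Pointwise in
/-- The set of conjugacy classes of subgroups of order `p` of `G`. -/
def subgroupClassesOfOrder (G : Type u) [Group G] (p : ℕ) :
    Set (MulAction.orbitRel.Quotient (ConjAct G) (Subgroup G)) :=
  (fun P : Subgroup G => (Quotient.mk'' P : MulAction.orbitRel.Quotient (ConjAct G) (Subgroup G)))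
    '' {P : Subgroup G | Nat.card P = p}

/-- The set of conjugacy classes of elements of order `p` of `G`. -/
def elementClassesOfOrder (G : Type u) [Group G] (p : ℕ) : Set (ConjClasses G) :=
  ConjClasses.mk '' {g : G | orderOf g = p}

end

/-!
The elements of order `p` of `G` are dense among those of `Ĝ`. As the elements of `Ĝ` conjugate to
an element of order `p` of `G` form a closed set, a finite union of compact conjugacy classes, every
element of order `p` lies in it.

For the density, let `γ` have order `p` and let `π : Ĝ → Q` be a finite quotient with `π γ ≠ 1` such
that `G ∩ ker π` is torsion-free of finite cohomological dimension. Write `C = ⟨γ⟩` and let `H` be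
the preimage of `π C` in `G`. By Shapiro's lemma and goodness, `Hⁿ(C, 𝔽_p)` is a direct summand of
`Hⁿ(Ĝ, coind 𝔽_p) = Hⁿ(G, coind 𝔽_p) = Hⁿ(H, 𝔽_p)`, where the modules are coinduced from `π C` to
`Q`; it is nonzero for all even `n > 0`. By a theorem of Serre `Hⁿ(H, 𝔽_p)` would vanish for large
`n` if `H` had no element of order `p`. So it has one, and some power of it has image `π γ` in `Q`.

For Serre's theorem, let `U` be normal in `H` of index `p` and of finite cohomological dimension,
and put `X = H / U`. As `H` has no element of order `p`, it acts freely on the maps `X → H`, so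
`Hom(M ^ ⊗X, W)` is a direct summand of an induced module whenever `M` is projective over `U`. An
exact sequence `0 → A → B → C → 0` filters the multilinear maps `B ^ X → W`; the graded pieces other
than `Hom(A ^ ⊗X, W)` and `Hom(C ^ ⊗X, W)` are indexed by the `j`-element subsets of `X` with
`0 < j < p`. If `p` kills `W`, they are direct summands of modules induced from `U`, since `j` is
invertible modulo `p`. Descending along a finite resolution of the trivial module `k` by modules
projective over `U`, one finds that `Hom(k ^ ⊗X, W) = W` has no cohomology in large degrees.
-/

noncomputable section

section Acyclicity

open Limits Filter

variable {k H : Type u} [CommRing k] [Group H]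

theorem isZero_of_retract {𝒞 : Type*} [Category* 𝒞] [HasZeroMorphisms 𝒞] {X Y : 𝒞}
    (r : Retract X Y) (hY : IsZero Y) : IsZero X :=
  (IsZero.iff_id_eq_zero X).2 <| by rw [← r.retract, hY.eq_of_src r.r 0, comp_zero]

theorem isZero_groupCohomology_of_retract {A B : Rep.{u} k H} (r : Retract A B) {n : ℕ}
    (hB : IsZero (groupCohomology B n)) : IsZero (groupCohomology A n) :=
  isZero_of_retract (r.map (groupCohomology.functor k H n)) hB

theorem shortExact_of_functionExact {A B C : Rep.{u} k H} {f : A ⟶ B} {g : B ⟶ C}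
    (hf : Function.Injective f.hom) (hg : Function.Surjective g.hom)
    (hfg : Function.Exact f.hom g.hom) (w : f ≫ g = 0) :
    (ShortComplex.mk f g w).ShortExact := by
  have := (Rep.mono_iff_injective f).2 hf
  have := (Rep.epi_iff_surjective g).2 hg
  refine ⟨?_⟩
  rwa [← ShortComplex.exact_map_iff_of_faithful _ (forget₂ (Rep.{u} k H) (ModuleCat k)),
    ShortComplex.ShortExact.moduleCat_exact_iff_function_exact]

/-- The coefficient modules whose cohomology vanishes in all large degrees. -/
def IsEventuallyAcyclic (W : Rep.{u} k H) : Prop :=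
  ∀ᶠ n in atTop, IsZero (groupCohomology W n)

namespace IsEventuallyAcyclic

theorem of_forall_succ {W : Rep.{u} k H} (h : ∀ n, IsZero (groupCohomology W (n + 1))) :
    IsEventuallyAcyclic W := by
  filter_upwards [eventually_ge_atTop 1] with n hn
  obtain ⟨m, rfl⟩ := Nat.exists_eq_add_of_le' hn
  exact h m

theorem of_retract {A B : Rep.{u} k H} (r : Retract A B) (hB : IsEventuallyAcyclic B) :
    IsEventuallyAcyclic A :=
  hB.mono fun _ => isZero_groupCohomology_of_retract r

theorem X₁ {S : ShortComplex (Rep.{u} k H)} (hS : S.ShortExact) (h₂ : IsEventuallyAcyclic S.X₂)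
    (h₃ : IsEventuallyAcyclic S.X₃) : IsEventuallyAcyclic S.X₁ := by
  rw [IsEventuallyAcyclic, ← map_add_atTop_eq_nat 1, eventually_map]
  filter_upwards [h₃, (tendsto_add_atTop_nat 1).eventually h₂] with n hn₃ hn₂
  exact (groupCohomology.mapShortComplex₁_exact hS rfl).isZero_of_both_zeros
    (hn₃.eq_of_src _ _) (hn₂.eq_of_tgt _ _)

end IsEventuallyAcyclic

end Acyclicity

section ProjectiveDimension

open Limits

variable {k H : Type u} [CommRing k] [Group H]

theorem isEquivalence_resFunctor {K : Type u} [Group K] (e : K ≃* H) :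
    (Rep.resFunctor.{u} (k := k) e.toMonoidHom).IsEquivalence where
  full := Rep.full_res _ e.surjective
  essSurj := ⟨fun M => ⟨Rep.res e.symm.toMonoidHom M,
    ⟨Rep.mkIso (.mk (LinearEquiv.refl k M) fun g => by ext; simp)⟩⟩⟩

theorem projective_res_of_injective {K : Type u} [Group K] {f : K →* H}
    (hf : Function.Injective f) (P : Rep.{u} k H) [Projective P] : Projective (Rep.res f P) := by
  let e := MonoidHom.ofInjective hf
  let P' : Rep.{u} k f.range := Rep.res f.range.subtype P
  have : Projective P' := (Rep.resFunctor f.range.subtype).projective_obj P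
  have := isEquivalence_resFunctor (k := k) e
  exact (Rep.resFunctor e.toMonoidHom).projective_obj P'

theorem hasProjectiveDimensionLT_res_of_injective {K : Type u} [Group K] {f : K →* H}
    (hf : Function.Injective f) {n : ℕ} {M : Rep.{u} k H}
    (hM : HasProjectiveDimensionLT M (n + 1)) :
    HasProjectiveDimensionLT (Rep.res f M) (n + 1) := by
  induction n generalizing M with
  | zero =>
    have := projective_iff_hasProjectiveDimensionLT_one.2 hM
    exact projective_iff_hasProjectiveDimensionLT_one.1 (projective_res_of_injective hf M)
  | succ n ih =>
    let S := ShortComplex.mk _ _ (kernel.condition (Projective.π M))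
    have hS : S.ShortExact := { exact := ShortComplex.exact_kernel _ }
    have hK := (hS.hasProjectiveDimensionLT_X₃_iff n (Projective.projective_over M)).1 hM
    exact (((Rep.shortExact_res f).2 hS).hasProjectiveDimensionLT_X₃_iff n
      (projective_res_of_injective hf (Projective.over M))).2 (ih hK)

theorem isEventuallyAcyclic_of_hasProjectiveDimensionLT {N : ℕ}
    (h : HasProjectiveDimensionLT (Rep.trivial k H k) N) (W : Rep.{u} k H) :
    IsEventuallyAcyclic W := by
  filter_upwards [Filter.eventually_ge_atTop (N + 1)] with n hn
  obtain ⟨m, rfl⟩ := Nat.exists_eq_add_of_le' ((Nat.le_add_left 1 N).trans hn)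
  let P := Rep.barResolution k H
  refine IsZero.of_iso ?_ (groupCohomologyIso W (m + 1) P)
  rw [← HomologicalComplex.exactAt_iff_isZero_homology,
    HomologicalComplex.exactAt_iff' _ m (m + 1) (m + 2) (by simp) (by simp),
    ShortComplex.moduleCat_exact_iff]
  intro (f : P.complex.X (m + 1) ⟶ W) (hf : P.complex.d (m + 2) (m + 1) ≫ f = 0)
  have := HasExt.standard (Rep.{u} k H)
  exact (P.extMk_eq_zero_iff f (m + 2) rfl hf m rfl).1
    (Abelian.Ext.eq_zero_of_hasProjectiveDimensionLT _ N (by lia))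

end ProjectiveDimension

section Averaging

open Limits

variable {k H : Type u} [CommRing k] [Group H] (E : Rep.{u} k H)

theorem coe_coind_apply {S : Type*} [Group S] (f : S →* H) {V : Type*} [AddCommGroup V]
    [Module k V] (σ : Representation k S V) (h x : H) (φ : Representation.coindV f σ) :
    (Representation.coind f σ h φ).1 x = φ.1 (x * h) := rfl

theorem isZero_groupCohomology_of_coind_retraction (S : Subgroup H)
    (r : Representation.coindV S.subtype (Rep.res S.subtype E).ρ →ₗ[k] E)
    (hr : ∀ h φ, r (Representation.coind S.subtype (Rep.res S.subtype E).ρ h φ) = E.ρ h (r φ))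
    (hi : ∀ v, r ⟨fun x => E.ρ x v, fun g h => by simp⟩ = v) {n : ℕ}
    (hE : IsZero (groupCohomology (Rep.res S.subtype E) n)) :
    IsZero (groupCohomology E n) := by
  let R : Retract E (Rep.coind S.subtype (Rep.res S.subtype E)) :=
    { i := Rep.ofHom
        { toFun v := ⟨fun x => E.ρ x v, fun g h => by simp⟩
          map_add' v w := by ext; simp
          map_smul' c v := by ext; simp
          isIntertwining' h := by
            ext v x
            exact (congrArg (fun f : E →ₗ[k] E => f v) (map_mul E.ρ x h)).symm }
      r := Rep.ofHom { r with isIntertwining' h := by ext φ; exact hr h φ }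
      retract := by ext v; exact hi v }
  exact isZero_groupCohomology_of_retract R
    (hE.of_iso (groupCohomology.coindIso (Rep.res S.subtype E) n))

theorem exists_equivariant_of_free (H : Type*) {Y : Type*} [Group H] [MulAction H Y]
    [IsCancelSMul H Y] : ∃ η : Y → H, ∀ h y, η (h • y) = η y * h⁻¹ := by
  let q (y : Y) : Y := (Quotient.mk (MulAction.orbitRel H Y) y).out
  have hq_smul (h : H) (y : Y) : q (h • y) = q y :=
    congrArg Quotient.out (Quotient.sound (MulAction.mem_orbit y h))
  have hq (y : Y) : ∃ g : H, g • y = q y := Quotient.mk_out (s := MulAction.orbitRel H Y) y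
  choose η hη using hq
  refine ⟨η, fun h y => eq_mul_inv_of_mul_eq (IsCancelSMul.right_cancel _ _ y ?_)⟩
  rw [mul_smul, hη, hη, hq_smul]

/-- If every `φ : Y → E` on a free `H`-set can be averaged equivariantly, then `E` is a retract of
an induced module. -/
theorem isEventuallyAcyclic_of_average (Y : Type*) [MulAction H Y] [IsCancelSMul H Y]
    (S : (Y → E) →ₗ[k] E) (hS : ∀ h φ, S (fun y => E.ρ h (φ (h⁻¹ • y))) = E.ρ h (S φ))
    (hS_const : ∀ v, S (fun _ => v) = v) : IsEventuallyAcyclic E := by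
  obtain ⟨η, hη⟩ := exists_equivariant_of_free H (Y := Y)
  let r : (H → E) →ₗ[k] E := S ∘ₗ LinearMap.pi fun y => E.ρ (η y)⁻¹ ∘ₗ LinearMap.proj (η y)
  refine .of_forall_succ fun n => isZero_groupCohomology_of_coind_retraction E ⊥
    (r ∘ₗ Submodule.subtype _) (fun h φ => ?_) (fun v => ?_)
    (isZero_groupCohomology_succ_of_subsingleton _ _)
  · refine Eq.trans (congrArg S (funext fun y => ?_)) (hS h _)
    simp [LinearMap.comp_apply, -Representation.coind_apply, coe_coind_apply, hη]
  · refine Eq.trans (congrArg S (funext fun y => ?_)) (hS_const v)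
    simp

/-- The identity of `E` is the trace from `U` to `H` of the `U`-equivariant endomorphism `e`. -/
theorem isZero_groupCohomology_of_trace (U : Subgroup H) [Fintype (H ⧸ U)]
    (e : E →ₗ[k] E) (he : ∀ u ∈ U, ∀ v, e (E.ρ u v) = E.ρ u (e v))
    (htrace : ∀ v, ∑ c : H ⧸ U, E.ρ c.out (e (E.ρ c.out⁻¹ v)) = v) {n : ℕ}
    (hE : IsZero (groupCohomology (Rep.res U.subtype E) n)) :
    IsZero (groupCohomology E n) := by
  have conj_eq (φ : Representation.coindV U.subtype (Rep.res U.subtype E).ρ) (a b : H)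
      (hab : (a : H ⧸ U) = b) : E.ρ a (e (φ.1 a⁻¹)) = E.ρ b (e (φ.1 b⁻¹)) := by
    have hu : a⁻¹ * b ∈ U := QuotientGroup.eq.1 hab
    have h1 : φ.1 a⁻¹ = E.ρ (a⁻¹ * b) (φ.1 b⁻¹) := by
      simpa [mul_assoc] using φ.2 ⟨a⁻¹ * b, hu⟩ b⁻¹
    rw [h1, he _ hu, ← Module.End.mul_apply, ← map_mul, mul_inv_cancel_left]
  refine isZero_groupCohomology_of_coind_retraction E U
    (∑ c : H ⧸ U, E.ρ c.out ∘ₗ e ∘ₗ LinearMap.proj c.out⁻¹ ∘ₗ Submodule.subtype _)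
    (fun h φ => ?_) (by simpa using htrace) hE
  simp only [LinearMap.sum_apply, LinearMap.comp_apply, map_sum]
  refine Fintype.sum_equiv (MulAction.toPerm h⁻¹) _ _ fun c => ?_
  have hc : ((h⁻¹ * c.out : H) : H ⧸ U) = ((MulAction.toPerm h⁻¹ c : H ⧸ U).out : H) := by
    rw [QuotientGroup.out_eq', MulAction.toPerm_apply, ← smul_eq_mul,
      MulAction.Quotient.coe_smul_out]
  refine Eq.trans ?_ (congrArg (E.ρ h) (conj_eq φ _ _ hc))
  simp [-Representation.coind_apply, coe_coind_apply]

end Averaging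

section FreeCover

variable {k H : Type u} [CommRing k] [Group H]

theorem exists_equivariant_sections (U : Subgroup H) {P M : Rep.{u} k H} (f : P ⟶ M) [Epi f]
    [Projective (Rep.res U.subtype M)] :
    ∃ s : H ⧸ U → M →ₗ[k] P, (∀ x m, f.hom (s x m) = m) ∧
      ∀ h x m, s (h • x) (M.ρ h m) = P.ρ h (s x m) := by
  have : Epi ((Rep.resFunctor U.subtype).map f) := (Rep.resFunctor U.subtype).map_epi f
  let t := Projective.factorThru (𝟙 _) ((Rep.resFunctor U.subtype).map f)
  have f_t (m : M) : f.hom (t.hom m) = m :=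
    congrArg (fun φ => φ.hom m)
      (Projective.factorThru_comp (𝟙 _) ((Rep.resFunctor U.subtype).map f))
  have t_smul (u : U) (m : M) : t.hom (M.ρ u m) = P.ρ u (t.hom m) := Rep.hom_comm_apply t u m
  have conj_eq {a b : H} (hab : (a : H ⧸ U) = b) (m : M) :
      P.ρ a (t.hom (M.ρ a⁻¹ m)) = P.ρ b (t.hom (M.ρ b⁻¹ m)) := by
    have h1 := t_smul ⟨a⁻¹ * b, QuotientGroup.eq.1 hab⟩ (M.ρ b⁻¹ m)
    simpa using congrArg (P.ρ a) h1
  refine ⟨fun x => P.ρ x.out ∘ₗ t.hom.toLinearMap ∘ₗ M.ρ x.out⁻¹, fun x m => ?_, fun h x m => ?_⟩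
  · simp [Rep.hom_comm_apply, f_t]
  · have hx : (((h • x).out : H) : H ⧸ U) = (h * x.out : H) := by
      rw [QuotientGroup.out_eq', ← smul_eq_mul, MulAction.Quotient.coe_smul_out]
    simpa using conj_eq hx (M.ρ h m)

variable (M : Rep.{u} k H)

open Classical in
/-- The diagonal action of `H` on `k[H] ⊗ M`, the sum of the copies of `M` indexed by `H`. -/
def diagonalAction : Representation k H (Π₀ _ : H, M) where
  toFun h := DFinsupp.lsum k fun x => DFinsupp.lsingle (h * x) ∘ₗ M.ρ h
  map_one' := by ext; simp
  map_mul' g h := by ext; simp [mul_assoc]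

open Classical in
theorem diagonalAction_single (h x : H) (m : M) :
    diagonalAction M h (DFinsupp.single x m) = DFinsupp.single (h * x) (M.ρ h m) := by
  simp [diagonalAction]

open Classical in
/-- The augmentation `k[H] ⊗ M ⟶ M`. -/
def augmentation : Rep.of (diagonalAction M) ⟶ M := Rep.ofHom
  { DFinsupp.lsum k fun _ : H => LinearMap.id with
    isIntertwining' h := by ext; simp [diagonalAction_single] }

open Classical in
theorem augmentation_single (x : H) (m : M) :
    (augmentation M).hom (DFinsupp.single x m) = m := by
  simp [augmentation]

open Classical in
instance : Epi (augmentation M) :=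
  (Rep.epi_iff_surjective _).2 fun m => ⟨DFinsupp.single 1 m, augmentation_single M 1 m⟩

end FreeCover

section Multilinear

variable {k H : Type u} [CommRing k] [Group H] (X : Type u) [MulAction H X] (M N : Rep.{u} k H)

/-- The action of `H` on the multilinear maps `M ^ X → N`, that is, on `Hom(M ^ ⊗X, N)`: the group
acts on `M`, on `N`, and by permuting `X`. -/
def multilinearAction : Representation k H (MultilinearMap k (fun _ : X => M) N) where
  toFun h :=
    { toFun f := (N.ρ h).compMultilinearMap
        ((f.domDomCongr (MulAction.toPerm h)).compLinearMap fun _ => M.ρ h⁻¹)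
      map_add' f g := by ext; simp
      map_smul' c f := by ext; simp }
  map_one' := by ext; simp [MulAction.toPerm_one]
  map_mul' g h := by ext; simp [mul_smul, MulAction.toPerm]

/-- The representation of `H` on multilinear maps given by `multilinearAction`. -/
abbrev multilinearRep : Rep.{u} k H := Rep.of (multilinearAction X M N)

variable {X M N}

theorem multilinearAction_apply (h : H) (f : MultilinearMap k (fun _ : X => M) N) (m : X → M) :
    multilinearAction X M N h f m = N.ρ h (f fun x => M.ρ h⁻¹ (m (h • x))) := rfl

end Multilinear

section Labelling

/-- The maps `X → H`, as an `H`-set under conjugation: `h • y` is `x ↦ h * y (h⁻¹ • x)`. -/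
def Labelling (H X : Type*) : Type _ := X → H

namespace Labelling

variable {H X : Type*} [Group H] [MulAction H X]

instance : SMul H (Labelling H X) := ⟨fun h y x => h * y (h⁻¹ • x)⟩

theorem smul_apply (h : H) (y : Labelling H X) (x : X) : (h • y) x = h * y (h⁻¹ • x) := rfl

instance : MulAction H (Labelling H X) where
  one_smul y := funext fun x => by simp [smul_apply]
  mul_smul g h y := funext fun x => by simp [smul_apply, mul_assoc, mul_smul]

theorem isCancelSMul (U : Subgroup H) [U.Normal] (hU : ∀ h : H, h ^ U.index = 1 → h = 1) :
    IsCancelSMul H (Labelling H (H ⧸ U)) := by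
  refine isCancelSMul_iff_eq_one_of_smul_eq.2 fun h y hy => hU h ?_
  have hpow : h ^ U.index • y = y := (MulAction.stabilizer H y).pow_mem hy _
  have hfix : (h ^ U.index)⁻¹ • ((1 : H) : H ⧸ U) = (1 : H) :=
    QuotientGroup.eq.2 (by simpa using U.pow_index_mem h)
  have := congrFun hpow (1 : H)
  rwa [smul_apply, hfix, mul_eq_right] at this

end Labelling

variable {k H : Type u} [CommRing k] [Group H] {X : Type u} {M N : Rep.{u} k H}

open Classical in
/-- Expanding each argument over `Π₀ _ : H, M` turns a family of multilinear maps `M ^ X → N`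
indexed by labellings into one multilinear map. -/
def labelledSum [Fintype X] : (Labelling H X → MultilinearMap k (fun _ : X => M) N) ≃ₗ[k]
    MultilinearMap k (fun _ : X => Π₀ _ : H, M) N :=
  MultilinearMap.fromDFinsuppEquiv (M := fun _ _ => M) (fun _ => H) k

open Classical in
theorem labelledSum_single [Fintype X]
    (φ : Labelling H X → MultilinearMap k (fun _ : X => M) N) (y : Labelling H X) (m : X → M) :
    labelledSum φ (fun x => DFinsupp.single (y x) (m x)) = φ y m :=
  congrArg (fun F => F y m) (labelledSum.symm_apply_apply φ)

theorem labelledSum_const [Fintype X] (f : MultilinearMap k (fun _ : X => M) N) :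
    labelledSum (fun _ : Labelling H X => f) =
      f.compLinearMap fun _ => (augmentation M).hom.toLinearMap := by
  classical
  refine MultilinearMap.dfinsupp_ext fun y => MultilinearMap.ext fun m => ?_
  refine (labelledSum_single _ y m).trans ?_
  exact congrArg f (funext fun x => (augmentation_single M (y x) (m x)).symm)

variable [MulAction H X]

theorem labelledSum_smul [Fintype X] (h : H)
    (φ : Labelling H X → MultilinearMap k (fun _ : X => M) N) :
    labelledSum (fun y => multilinearAction X M N h (φ (h⁻¹ • y))) =
      multilinearAction X (Rep.of (diagonalAction M)) N h (labelledSum φ) := by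
  classical
  refine MultilinearMap.dfinsupp_ext fun (y : Labelling H X) => MultilinearMap.ext fun m => ?_
  have h_act (x : X) : diagonalAction M h⁻¹ (DFinsupp.single (y (h • x)) (m (h • x))) =
      DFinsupp.single ((h⁻¹ • y) x) (M.ρ h⁻¹ (m (h • x))) := by
    rw [diagonalAction_single, Labelling.smul_apply, inv_inv]
  refine (labelledSum_single _ y m).trans (congrArg (N.ρ h) ?_)
  refine (labelledSum_single φ (h⁻¹ • y) _).symm.trans ?_
  exact congrArg (labelledSum φ) (funext fun x => (h_act x).symm)

/-- Through equivariant splittings of the augmentation, the multilinear maps `M ^ X → N` form a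
retract of the functions from the labellings of `X` to themselves. -/
theorem isEventuallyAcyclic_multilinearRep [Finite X] [IsCancelSMul H (Labelling H X)]
    (s : X → M →ₗ[k] Π₀ _ : H, M) (hs : ∀ x m, (augmentation M).hom (s x m) = m)
    (hs_smul : ∀ h x m, s (h • x) (M.ρ h m) = diagonalAction M h (s x m)) :
    IsEventuallyAcyclic (multilinearRep X M N) := by
  have := Fintype.ofFinite X
  refine isEventuallyAcyclic_of_average _ (Labelling H X)
    (MultilinearMap.compLinearMapₗ s ∘ₗ labelledSum.toLinearMap) (fun h φ => ?_) fun f => ?_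
  · ext m
    refine (congrArg (fun F => F fun x => s x (m x)) (labelledSum_smul h φ)).trans ?_
    simp [multilinearAction_apply, ← hs_smul]
  · ext m
    simp [labelledSum_const, hs]

end Labelling

section Filtration

variable {k H : Type u} [CommRing k] [Group H] {A B C N : Rep.{u} k H}

/-- A splitting of `A ⟶ B ⟶ C` as a short exact sequence of `k`-modules; it need not be
equivariant. -/
structure LinearSplitting (f : A ⟶ B) (g : B ⟶ C) where
  /-- the linear retraction of `f` -/
  retr : B →ₗ[k] A
  /-- the linear section of `g` -/
  sect : C →ₗ[k] B
  retr_apply : ∀ a, retr (f.hom a) = a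
  apply_sect : ∀ c, g.hom (sect c) = c
  apply_retr_add : ∀ b, f.hom (retr b) + sect (g.hom b) = b

variable {f : A ⟶ B} {g : B ⟶ C}

namespace LinearSplitting

variable (s : LinearSplitting f g)
include s

theorem apply_apply (a : A) : g.hom (f.hom a) = 0 := by
  simpa [s.retr_apply, s.apply_sect] using congrArg g.hom (s.apply_retr_add (f.hom a))

theorem apply_retr_of_eq_zero {b : B} (hb : g.hom b = 0) : f.hom (s.retr b) = b := by
  simpa [hb] using s.apply_retr_add b

end LinearSplitting

theorem nonempty_linearSplitting {S : ShortComplex (Rep.{u} k H)} (hS : S.ShortExact)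
    [Module.Projective k S.X₃] : Nonempty (LinearSplitting S.f S.g) := by
  have hf : Function.Injective S.f.hom := (Rep.mono_iff_injective S.f).1 hS.mono_f
  have hg : Function.Surjective S.g.hom := (Rep.epi_iff_surjective S.g).1 hS.epi_g
  have hfg : Function.Exact S.f.hom.toLinearMap S.g.hom.toLinearMap :=
    (ShortComplex.ShortExact.moduleCat_exact_iff_function_exact _).1
      (hS.exact.map (forget₂ (Rep.{u} k H) (ModuleCat k)))
  obtain ⟨sect, hsect⟩ := Module.projective_lifting_property S.g.hom.toLinearMap LinearMap.id hg
  obtain ⟨e, he_symm, he⟩ := hfg.splitSurjectiveEquiv hf ⟨sect, hsect⟩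
  have f_apply (a : S.X₁) : S.f.hom a = e.symm (a, 0) := congrArg (fun φ => φ a) he_symm
  have g_apply (b : S.X₂) : S.g.hom b = (e b).2 := congrArg (fun φ => φ b) he
  exact ⟨{
    retr := LinearMap.fst k _ _ ∘ₗ e.toLinearMap
    sect := e.symm.toLinearMap ∘ₗ LinearMap.inr k _ _
    retr_apply a := by simp [f_apply]
    apply_sect c := by simp [g_apply]
    apply_retr_add b := by simp [f_apply, g_apply, ← map_add] }⟩

variable {X : Type u} [Fintype X]

open scoped Classical in
/-- The set of coordinates of a family `b` that are killed by `g`. -/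
def zeroCoords (g : B ⟶ C) (b : X → B) : Finset X := {x | g.hom (b x) = 0}

theorem mem_zeroCoords {b : X → B} {x : X} : x ∈ zeroCoords g b ↔ g.hom (b x) = 0 := by
  simp [zeroCoords]

variable (N X) in
/-- The multilinear maps that vanish as soon as `j` of the arguments are killed by `g`: an
increasing filtration, from the maps that factor through `g` (`j = 1`) to those that vanish on the
kernel of `g` (`j = card X`). -/
def vanishing (g : B ⟶ C) (j : ℕ) : Submodule k (MultilinearMap k (fun _ : X => B) N) where
  carrier := {φ | ∀ b, j ≤ (zeroCoords g b).card → φ b = 0}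
  add_mem' hφ hψ b hb := by simp [hφ b hb, hψ b hb]
  zero_mem' b _ := rfl
  smul_mem' c φ hφ b hb := by simp [hφ b hb]

theorem vanishing_mono {i j : ℕ} (hij : i ≤ j) : vanishing N X g i ≤ vanishing N X g j :=
  fun _ hφ b hb => hφ b (hij.trans hb)

theorem apply_eq_of_mem_vanishing_one {φ : MultilinearMap k (fun _ : X => B) N}
    (hφ : φ ∈ vanishing N X g 1) {b b' : X → B} (h : ∀ x, g.hom (b x) = g.hom (b' x)) :
    φ b = φ b' := by
  classical
  rw [← sub_add_cancel b b', add_comm, φ.map_add_univ, Finset.sum_eq_single Finset.univ]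
  · rw [Finset.piecewise_univ]
  · intro t _ ht
    obtain ⟨x, hx⟩ : ∃ x, x ∉ t := by simpa [Finset.eq_univ_iff_forall] using ht
    exact hφ _ (Finset.card_pos.2 ⟨x, mem_zeroCoords.2 (by simp [hx, h])⟩)
  · simp

open scoped Classical in
/-- Projection of the argument of index `x` onto `A`. -/
def projectArg (s : LinearSplitting f g) (x : X) :
    Module.End k (MultilinearMap k (fun _ : X => B) N) :=
  MultilinearMap.compLinearMapₗ
    (Function.update (fun _ => LinearMap.id) x (f.hom.toLinearMap ∘ₗ s.retr))

open scoped Classical in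
theorem projectArg_apply (s : LinearSplitting f g) {x : X} {j : ℕ}
    {φ : MultilinearMap k (fun _ : X => B) N} (hφ : φ ∈ vanishing N X g (j + 1)) {b : X → B}
    (hb : j ≤ (zeroCoords g b).card) :
    projectArg s x φ b = if x ∈ zeroCoords g b then φ b else 0 := by
  let b' := Function.update b x (f.hom (s.retr (b x)))
  have h_apply : projectArg s x φ b = φ b' := by
    refine congrArg φ (funext fun y => ?_)
    rcases eq_or_ne y x with rfl | hy <;> simp [b', *]
  rw [h_apply]
  split_ifs with hx
  · rw [show b' = b by simp [b', s.apply_retr_of_eq_zero (mem_zeroCoords.1 hx)]]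
  · refine hφ _ ((Nat.succ_le_succ hb).trans ?_)
    rw [Nat.succ_eq_add_one, ← Finset.card_insert_of_notMem hx]
    refine Finset.card_le_card fun y hy => mem_zeroCoords.2 ?_
    rcases eq_or_ne y x with rfl | hyx
    · simp [b', s.apply_apply]
    · simpa [b', hyx] using mem_zeroCoords.1 (Finset.mem_of_mem_insert_of_ne hy hyx)

theorem projectArg_mem_vanishing (s : LinearSplitting f g) (x : X) {j : ℕ}
    {φ : MultilinearMap k (fun _ : X => B) N} (hφ : φ ∈ vanishing N X g (j + 1)) :
    projectArg s x φ ∈ vanishing N X g (j + 1) := fun b hb => by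
  rw [projectArg_apply s hφ (Nat.le_of_succ_le hb), hφ b hb, ite_self]

variable [MulAction H X]

theorem mem_zeroCoords_smul (h : H) (b : X → B) (x : X) :
    x ∈ zeroCoords g (fun x => B.ρ h⁻¹ (b (h • x))) ↔ h • x ∈ zeroCoords g b := by
  rw [mem_zeroCoords, mem_zeroCoords, Rep.hom_comm_apply]
  exact map_eq_zero_iff _ (C.ρ.apply_bijective h⁻¹).injective

theorem card_zeroCoords_smul (h : H) (b : X → B) :
    (zeroCoords g fun x => B.ρ h⁻¹ (b (h • x))).card = (zeroCoords g b).card :=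
  Finset.card_equiv (MulAction.toPerm h) fun x => mem_zeroCoords_smul h b x

theorem vanishing_le_comap (j : ℕ) (h : H) :
    vanishing N X g j ≤ (vanishing N X g j).comap (multilinearAction X B N h) := by
  intro φ hφ b hb
  rw [multilinearAction_apply, hφ _ (by rwa [card_zeroCoords_smul]), map_zero]

variable (N X) in
/-- The subrepresentation `vanishing` of the representation on multilinear maps. -/
abbrev vanishingRep (g : B ⟶ C) (j : ℕ) : Rep.{u} k H :=
  Rep.subrepresentation (multilinearRep X B N) (vanishing N X g j) (vanishing_le_comap j)

variable (N X) in
/-- Precomposition with `f`, as a map of representations on multilinear maps. -/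
def multilinearRes (f : A ⟶ B) : multilinearRep X B N ⟶ multilinearRep X A N := Rep.ofHom
  { MultilinearMap.compLinearMapₗ (fun _ : X => f.hom.toLinearMap) with
    isIntertwining' h := by
      ext φ a
      exact congrArg (fun b => N.ρ h (φ b)) (funext fun x => (Rep.hom_comm_apply f _ _).symm) }

theorem isEventuallyAcyclic_vanishingRep_card (s : LinearSplitting f g)
    (hA : IsEventuallyAcyclic (multilinearRep X A N))
    (hB : IsEventuallyAcyclic (multilinearRep X B N)) :
    IsEventuallyAcyclic (vanishingRep N X g (Fintype.card X)) := by
  have h_zero (φ : vanishing N X g (Fintype.card X)) : (multilinearRes N X f).hom φ.1 = 0 :=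
    MultilinearMap.ext fun a => φ.2 _ <|
      Finset.card_le_card fun x _ => mem_zeroCoords.2 (s.apply_apply (a x))
  refine IsEventuallyAcyclic.X₁ (shortExact_of_functionExact
    (f := Rep.subtype (multilinearRep X B N) (vanishing N X g (Fintype.card X))
      (vanishing_le_comap _)) (g := multilinearRes N X f)
    Subtype.val_injective (fun φ => ⟨φ.compLinearMap fun _ => s.retr, ?_⟩)
    (fun φ => ⟨fun hφ => ⟨⟨φ, fun b hb => ?_⟩, rfl⟩, ?_⟩) ?_) hB hA
  · ext a
    exact congrArg φ (funext fun x => s.retr_apply _)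
  · have hb' (x : X) : f.hom (s.retr (b x)) = b x := s.apply_retr_of_eq_zero <| by
      rw [← mem_zeroCoords (g := g) (b := b),
        (Finset.card_eq_iff_eq_univ _).1 (le_antisymm (Finset.card_le_univ _) hb)]
      exact Finset.mem_univ x
    rw [← funext hb']
    exact congrArg (fun ψ : MultilinearMap k (fun _ : X => A) N => ψ fun x => s.retr (b x)) hφ
  · rintro ⟨φ, rfl⟩
    exact h_zero φ
  · ext φ a
    exact congrArg (fun ψ : MultilinearMap k (fun _ : X => A) N => ψ a) (h_zero φ)

theorem isEventuallyAcyclic_of_vanishingRep_one (s : LinearSplitting f g)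
    (h : IsEventuallyAcyclic (vanishingRep N X g 1)) :
    IsEventuallyAcyclic (multilinearRep X C N) := by
  refine .of_retract
    { i := Rep.ofHom
        { LinearMap.codRestrict (vanishing N X g 1) (multilinearRes N X g).hom.toLinearMap
            fun φ b hb => ?_ with
          isIntertwining' h := ?_ }
      r := Rep.ofHom
        { MultilinearMap.compLinearMapₗ (fun _ : X => s.sect) ∘ₗ Submodule.subtype _ with
          isIntertwining' h := ?_ }
      retract := ?_ } h
  · obtain ⟨x, hx⟩ := Finset.card_pos.1 hb
    exact φ.map_coord_zero x (mem_zeroCoords.1 hx)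
  · ext φ : 1
    exact Subtype.ext (Rep.hom_comm_apply (multilinearRes N X g) h φ)
  · ext φ c
    refine congrArg (N.ρ h) (apply_eq_of_mem_vanishing_one φ.2 fun x => ?_)
    refine (Rep.hom_comm_apply g h⁻¹ _).trans (Eq.trans ?_ (s.apply_sect _).symm)
    exact congrArg (C.ρ h⁻¹) (s.apply_sect (c (h • x)))
  · ext φ c
    exact congrArg φ (funext fun x => s.apply_sect _)

end Filtration

section GradedPieces

variable {k H : Type u} [CommRing k] [Group H] {A B C N : Rep.{u} k H} {f : A ⟶ B} {g : B ⟶ C}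
  {X : Type u} [Fintype X] [MulAction H X]

variable (N X) in
/-- The graded piece of degree `j` of the filtration by the subrepresentations `vanishingRep`. -/
def gradedPiece (g : B ⟶ C) (j : ℕ) : Rep.{u} k H :=
  Rep.quotient (vanishingRep N X g (j + 1))
    ((vanishing N X g j).submoduleOf (vanishing N X g (j + 1)))
    fun h _ hφ => vanishing_le_comap j h hφ

/-- The class of a multilinear map in `gradedPiece`. -/
def gradedPiece.mk {j : ℕ} : vanishing N X g (j + 1) →ₗ[k] gradedPiece N X g j :=
  Submodule.mkQ _

namespace gradedPiece

variable {j : ℕ}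

theorem mk_surjective : Function.Surjective (mk : _ →ₗ[k] gradedPiece N X g j) :=
  Submodule.mkQ_surjective _

theorem mk_eq_mk {φ ψ : vanishing N X g (j + 1)} :
    (mk φ : gradedPiece N X g j) = mk ψ ↔ ∀ b, j ≤ (zeroCoords g b).card → φ.1 b = ψ.1 b := by
  refine (Submodule.Quotient.eq _).trans (forall₂_congr fun b _ => ?_)
  exact sub_eq_zero (a := φ.1 b)

theorem isEventuallyAcyclic_vanishingRep (hQ : IsEventuallyAcyclic (gradedPiece N X g j))
    (h : IsEventuallyAcyclic (vanishingRep N X g (j + 1))) :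
    IsEventuallyAcyclic (vanishingRep N X g j) := by
  let i : vanishingRep N X g j ⟶ vanishingRep N X g (j + 1) := Rep.ofHom
    { Submodule.inclusion (vanishing_mono j.le_succ) with
      isIntertwining' h := by ext; rfl }
  refine IsEventuallyAcyclic.X₁ (shortExact_of_functionExact (f := i) (g := Rep.mkQ _ _ _)
    (Submodule.inclusion_injective (vanishing_mono j.le_succ)) (Submodule.mkQ_surjective _)
    (fun φ => (Submodule.Quotient.mk_eq_zero _).trans ⟨fun hφ => ⟨⟨φ.1, hφ⟩, rfl⟩, ?_⟩) ?_) h hQ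
  · rintro ⟨ψ, rfl⟩
    exact ψ.2
  · ext ψ
    exact (Submodule.Quotient.mk_eq_zero _).2 ψ.2

/-- The endomorphism of `gradedPiece` induced by `projectArg`. -/
def project (s : LinearSplitting f g) (j : ℕ) (x : X) : Module.End k (gradedPiece N X g j) :=
  Submodule.mapQ _ _ ((projectArg s x).restrict fun _ => projectArg_mem_vanishing s x)
    fun φ hφ b hb => by
      refine (projectArg_apply s φ.2 hb).trans ?_
      rw [show φ.1 b = 0 from hφ b hb, ite_self]

theorem project_mk (s : LinearSplitting f g) (x : X) (φ : vanishing N X g (j + 1)) :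
    project s j x (mk φ) = mk ⟨projectArg s x φ.1, projectArg_mem_vanishing s x φ.2⟩ := rfl

theorem ρ_mk (h : H) (φ : vanishing N X g (j + 1)) :
    (gradedPiece N X g j).ρ h (mk φ) =
      mk ⟨multilinearAction X B N h φ.1, vanishing_le_comap _ h φ.2⟩ := rfl

theorem ρ_project (s : LinearSplitting f g) (h : H) (x : X) (v : gradedPiece N X g j) :
    (gradedPiece N X g j).ρ h (project s j x v) =
      project s j (h • x) ((gradedPiece N X g j).ρ h v) := by
  classical
  obtain ⟨φ, rfl⟩ := mk_surjective v
  rw [ρ_mk, project_mk, project_mk, ρ_mk, mk_eq_mk]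
  intro b hb
  rw [projectArg_apply s (vanishing_le_comap _ h φ.2) hb, multilinearAction_apply,
    projectArg_apply s φ.2 (by rwa [card_zeroCoords_smul]), apply_ite (N.ρ h), map_zero,
    ← multilinearAction_apply]
  simp only [mem_zeroCoords_smul]

theorem sum_project (s : LinearSplitting f g) (v : gradedPiece N X g j) :
    ∑ x, project s j x v = j • v := by
  classical
  obtain ⟨φ, rfl⟩ := mk_surjective v
  rw [Finset.sum_congr rfl fun x _ => project_mk s x φ, ← map_sum, ← map_nsmul, mk_eq_mk]
  intro b hb
  have h_sum : ∑ x, projectArg s x φ.1 b = (zeroCoords g b).card • φ.1 b := by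
    simp_rw [projectArg_apply s φ.2 hb]
    rw [Finset.sum_ite_mem, Finset.univ_inter, Finset.sum_const]
  rw [Submodule.coe_sum, sum_apply, h_sum, Submodule.coe_smul_of_tower, smul_apply]
  rcases hb.eq_or_lt with heq | hlt
  · rw [← heq]
  · rw [φ.2 b hlt, smul_zero, smul_zero]

theorem isEventuallyAcyclic {U : Subgroup H} [Fintype (H ⧸ U)] (s : LinearSplitting f g) {a : ℕ}
    (ha : ∀ v : N, (a * j) • v = v)
    (hU : IsEventuallyAcyclic (Rep.res U.subtype (gradedPiece N (H ⧸ U) g j))) :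
    IsEventuallyAcyclic (gradedPiece N (H ⧸ U) g j) := by
  let E := gradedPiece N (H ⧸ U) g j
  refine hU.mono fun n hn => isZero_groupCohomology_of_trace E U
    (a • project s j ((1 : H) : H ⧸ U)) (fun u hu v => ?_) (fun v => ?_) hn
  · have hu' : u • ((1 : H) : H ⧸ U) = (1 : H) := QuotientGroup.eq.2 (by simpa using hu)
    rw [LinearMap.smul_apply, LinearMap.smul_apply, map_nsmul, ρ_project, hu']
  · have h_conj (c : H ⧸ U) :
        E.ρ c.out ((a • project s j ((1 : H) : H ⧸ U)) (E.ρ c.out⁻¹ v)) = a • project s j c v := by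
      have hc : c.out • ((1 : H) : H ⧸ U) = c := by
        rw [MulAction.Quotient.smul_coe, smul_eq_mul, mul_one, QuotientGroup.out_eq']
      rw [LinearMap.smul_apply, map_nsmul, ρ_project, hc, Representation.self_inv_apply]
    obtain ⟨φ, rfl⟩ := mk_surjective v
    rw [Finset.sum_congr rfl fun c _ => h_conj c, ← Finset.smul_sum, sum_project, smul_smul,
      ← map_nsmul, mk_eq_mk]
    exact fun b _ => ha (φ.1 b)

end gradedPiece

end GradedPieces

section Serre

open Limits

variable {k H : Type u} [CommRing k] [Group H]

theorem moduleProjective_of_projective (P : Rep.{u} k H) [Projective P] :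
    Module.Projective k P := by
  let π := Rep.freeLift k H P (id : P → P)
  have : Epi π := (Rep.epi_iff_surjective π).2 fun v =>
    ⟨Finsupp.single v (.single 1 1), by simp [π]⟩
  have : Module.Projective k (Rep.free k H P) :=
    inferInstanceAs (Module.Projective k (P →₀ MonoidAlgebra k H))
  let t := Projective.factorThru (𝟙 P) π
  refine .of_split t.hom.toLinearMap π.hom.toLinearMap (LinearMap.ext fun v => ?_)
  exact congrArg (fun φ => φ.hom v) (Projective.factorThru_comp (𝟙 P) π)

/-- `W` sits in `Hom(k ^ ⊗X, W)` as the constants, and evaluation at `1` retracts it. -/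
def retractMultilinearRepTrivial (X : Type u) [Fintype X] [MulAction H X] (W : Rep.{u} k H) :
    Retract W (multilinearRep X (Rep.trivial k H k) W) where
  i := Rep.ofHom
    { (MultilinearMap.piRingEquiv (R := k) (ι := X) (M₂ := W)).toLinearMap with
      isIntertwining' h := by
        refine LinearMap.ext fun w => MultilinearMap.ext fun (m : X → k) => ?_
        refine Eq.trans ?_ (map_smul (W.ρ h) (∏ x, m (h • x)) w).symm
        rw [Fintype.prod_equiv (MulAction.toPerm h) (fun x => m (h • x)) m fun x => rfl]
        rfl }
  r := Rep.ofHom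
    { toFun (f : MultilinearMap k (fun _ : X => k) W) := f 1
      map_add' f g := rfl
      map_smul' c f := rfl
      isIntertwining' h := rfl }
  retract := by
    ext w
    exact (congrArg (· • w) (Finset.prod_const_one (s := (Finset.univ : Finset X)))).trans
      (one_smul k w)

theorem exists_mul_nsmul_eq {p j : ℕ} (hp : p.Prime) (hj : 0 < j) (hjp : j < p) {W : Type*}
    [AddCommGroup W] (hW : ∀ w : W, p • w = 0) : ∃ a : ℕ, ∀ w : W, (a * j) • w = w := by
  obtain ⟨a, -, ha⟩ := Nat.exists_mul_mod_eq_one_of_coprime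
    (Nat.coprime_of_lt_prime hj.ne' hjp hp).symm hp.one_lt
  refine ⟨a, fun w => ?_⟩
  rw [mul_comm, ← Nat.mod_add_div (j * a) p, ha, add_smul, mul_smul, hW, one_smul, add_zero]

variable {U : Subgroup H}

theorem isEventuallyAcyclic_multilinearRep_of_linearSplitting [U.FiniteIndex]
    (hU : ∀ V : Rep.{u} k U, IsEventuallyAcyclic V) (hp : U.index.Prime) {W : Rep.{u} k H}
    (hW : ∀ w : W, U.index • w = 0) {A B C : Rep.{u} k H} {f : A ⟶ B} {g : B ⟶ C}
    (s : LinearSplitting f g) (hA : IsEventuallyAcyclic (multilinearRep (H ⧸ U) A W))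
    (hB : IsEventuallyAcyclic (multilinearRep (H ⧸ U) B W)) :
    IsEventuallyAcyclic (multilinearRep (H ⧸ U) C W) := by
  have := U.fintypeQuotientOfFiniteIndex
  have hcard : Fintype.card (H ⧸ U) = U.index := by
    rw [Subgroup.index, Nat.card_eq_fintype_card]
  refine isEventuallyAcyclic_of_vanishingRep_one s ?_
  refine Nat.decreasingInduction' (P := fun j => IsEventuallyAcyclic (vanishingRep W (H ⧸ U) g j))
    (fun j hj hj_pos h => ?_) hp.one_le (hcard ▸ isEventuallyAcyclic_vanishingRep_card s hA hB)
  obtain ⟨a, ha⟩ := exists_mul_nsmul_eq hp hj_pos hj hW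
  exact gradedPiece.isEventuallyAcyclic_vanishingRep (gradedPiece.isEventuallyAcyclic s ha (hU _)) h

theorem isEventuallyAcyclic_multilinearRep_of_hasProjectiveDimensionLT [U.Normal] [U.FiniteIndex]
    (hU : ∀ V : Rep.{u} k U, IsEventuallyAcyclic V) (hp : U.index.Prime)
    (hH : ∀ h : H, h ^ U.index = 1 → h = 1) {W : Rep.{u} k H} (hW : ∀ w : W, U.index • w = 0)
    {n : ℕ} (M : Rep.{u} k H) [Module.Projective k M]
    (hM : HasProjectiveDimensionLT (Rep.res U.subtype M) (n + 1)) :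
    IsEventuallyAcyclic (multilinearRep (H ⧸ U) M W) := by
  have of_projective (P : Rep.{u} k H) [Projective (Rep.res U.subtype P)] :
      IsEventuallyAcyclic (multilinearRep (H ⧸ U) P W) := by
    have := Labelling.isCancelSMul U hH
    obtain ⟨s, hs, hs_smul⟩ := exists_equivariant_sections U (augmentation P)
    exact isEventuallyAcyclic_multilinearRep s hs hs_smul
  induction n generalizing M with
  | zero =>
    have := projective_iff_hasProjectiveDimensionLT_one.2 hM
    exact of_projective M
  | succ n ih =>
    let S := ShortComplex.mk _ _ (kernel.condition (Projective.π M))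
    have hS : S.ShortExact := { exact := ShortComplex.exact_kernel _ }
    have := Projective.projective_over M
    have hP : Projective (Rep.res U.subtype (Projective.over M)) :=
      projective_res_of_injective U.subtype_injective _
    have : Module.Projective k S.X₂ := moduleProjective_of_projective (Projective.over M)
    obtain ⟨s⟩ := nonempty_linearSplitting hS
    have : Module.Projective k S.X₁ := .of_split S.f.hom.toLinearMap s.retr
      (LinearMap.ext s.retr_apply)
    exact isEventuallyAcyclic_multilinearRep_of_linearSplitting hU hp hW s
      (ih S.X₁ ((((Rep.shortExact_res _).2 hS).hasProjectiveDimensionLT_X₃_iff n hP).1 hM))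
      (of_projective S.X₂)

/-- A case of Serre's theorem on the cohomological dimension of overgroups of finite index. -/
theorem isEventuallyAcyclic_of_index_prime [U.Normal] {n : ℕ}
    (hU : HasProjectiveDimensionLT (Rep.trivial k U k) (n + 1)) (hp : U.index.Prime)
    (hH : ∀ h : H, h ^ U.index = 1 → h = 1) {W : Rep.{u} k H} (hW : ∀ w : W, U.index • w = 0) :
    IsEventuallyAcyclic W := by
  have : U.FiniteIndex := ⟨hp.ne_zero⟩
  have := U.fintypeQuotientOfFiniteIndex
  have : Module.Projective k (Rep.trivial k H k) := inferInstanceAs (Module.Projective k k)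
  exact .of_retract (retractMultilinearRepTrivial (H ⧸ U) W)
    (isEventuallyAcyclic_multilinearRep_of_hasProjectiveDimensionLT
      (isEventuallyAcyclic_of_hasProjectiveDimensionLT hU) hp hH hW _ hU)

end Serre

section Shapiro

variable {k C Q : Type u} [CommRing k] [Group C] [Group Q]

theorem partialProd_injective {n : ℕ} :
    Function.Injective (Fin.partialProd : (Fin n → C) → Fin (n + 1) → C) := fun s t h => by
  ext i
  rw [← Fin.partialProd_right_inv s, ← Fin.partialProd_right_inv t, h]

theorem map_partialProd (φ : C →* Q) {n : ℕ} (g : Fin n → C) (i : Fin (n + 1)) :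
    φ (Fin.partialProd g i) = Fin.partialProd (φ ∘ g) i := by
  simp [Fin.partialProd, map_list_prod, List.map_take, List.map_ofFn]

/-- The path of `Q` which starts at `x` and has the steps `gᵢ` is mapped by `σ` to a path of `C`;
these are the steps of the latter. -/
def shapiroTuple (σ : Q → C) (x : Q) {n : ℕ} (g : Fin n → Q) (i : Fin n) : C :=
  (σ (x * Fin.partialProd g i.castSucc))⁻¹ * σ (x * Fin.partialProd g i.succ)

theorem partialProd_shapiroTuple (σ : Q → C) (x : Q) {n : ℕ} (g : Fin n → Q) (i : Fin (n + 1)) :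
    Fin.partialProd (shapiroTuple σ x g) i = (σ x)⁻¹ * σ (x * Fin.partialProd g i) := by
  induction i using Fin.induction with
  | zero => simp
  | succ i ih => rw [Fin.partialProd_succ, ih, shapiroTuple]; group

theorem shapiroTuple_contractNth (σ : Q → C) (x : Q) {n : ℕ} (g : Fin (n + 1) → Q)
    (j : Fin (n + 1)) : shapiroTuple σ x (Fin.contractNth j (· * ·) g) =
      Fin.contractNth j (· * ·) (shapiroTuple σ x g) := by
  refine partialProd_injective (funext fun i => ?_)
  simp only [partialProd_shapiroTuple, Fin.partialProd_contractNth, Function.comp_apply]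

theorem shapiroTuple_tail (σ : Q → C) (x : Q) {n : ℕ} (g : Fin (n + 1) → Q) :
    shapiroTuple σ (x * g 0) (fun i => g i.succ) = fun i => shapiroTuple σ x g i.succ := by
  ext i
  simp only [shapiroTuple, ← Fin.succ_castSucc, Fin.partialProd_succ', ← mul_assoc]
  rfl

theorem mul_shapiroTuple_zero (σ : Q → C) (x : Q) {n : ℕ} (g : Fin (n + 1) → Q) :
    σ x * shapiroTuple σ x g 0 = σ (x * g 0) := by
  have partialProd_one : Fin.partialProd g 1 = g 0 := by simpa using Fin.partialProd_succ g 0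
  simp [shapiroTuple, partialProd_one]

theorem exists_equivariant_of_injective {φ : C →* Q} (hφ : Function.Injective φ) :
    ∃ σ : Q → C, (∀ c x, σ (φ c * x) = c * σ x) ∧ σ 1 = 1 := by
  let _ := MulAction.compHom Q φ
  have : IsCancelSMul C Q := ⟨fun c d x h => hφ (mul_right_cancel (b := x) h)⟩
  obtain ⟨η, hη⟩ := exists_equivariant_of_free C (Y := Q)
  refine ⟨fun x => (η x)⁻¹ * η 1, fun c x => ?_, inv_mul_cancel _⟩
  have hηx : η (φ c * x) = η x * c⁻¹ := hη c x
  simp only [hηx, mul_inv_rev, inv_inv, mul_assoc]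

variable {φ : C →* Q} {A : Rep.{u} k C} {σ : Q → C}

theorem shapiroTuple_mul (hσ : ∀ c x, σ (φ c * x) = c * σ x) (c : C) (x : Q) {n : ℕ}
    (g : Fin n → Q) : shapiroTuple σ (φ c * x) g = shapiroTuple σ x g := by
  ext i
  simp only [shapiroTuple, mul_assoc, hσ]
  group

variable (hσ : ∀ c x, σ (φ c * x) = c * σ x)

/-- The cochain `Qⁿ → coind A` which corresponds to the cochain `f : Cⁿ → A` by Shapiro's lemma,
for a `C`-equivariant map `σ : Q → C`. -/
def shapiroCochain {n : ℕ} (f : (Fin n → C) → A) (g : Fin n → Q) : Rep.coind φ A :=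
  ⟨fun x => A.ρ (σ x) (f (shapiroTuple σ x g)), (Representation.mem_coindV ..).2 fun c x => by
    simp only [shapiroTuple_mul hσ, hσ, map_mul, Module.End.mul_apply]⟩

theorem d_shapiroCochain {n : ℕ} (f : (Fin n → C) → A) :
    (inhomogeneousCochains.d (Rep.coind φ A) n).hom (shapiroCochain hσ f) =
      shapiroCochain hσ ((inhomogeneousCochains.d A n).hom f) := by
  ext g x
  simp only [inhomogeneousCochains.d_hom_apply, shapiroCochain, Submodule.coe_add,
    AddSubmonoidClass.coe_finsetSum, Finset.sum_apply, Pi.add_apply, SetLike.val_smul, map_add,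
    map_sum, map_smul, Pi.smul_apply, shapiroTuple_contractNth]
  rw [coe_coind_apply, ← Module.End.mul_apply, ← map_mul, mul_shapiroTuple_zero,
    ← shapiroTuple_tail]

/-- The cochain map inducing the isomorphism `Hⁿ(C, A) ≅ Hⁿ(Q, coind A)` of Shapiro's lemma. -/
def shapiroMap : groupCohomology.inhomogeneousCochains A ⟶
    groupCohomology.inhomogeneousCochains (Rep.coind φ A) where
  f n := ModuleCat.ofHom
    { toFun := shapiroCochain hσ
      map_add' f f' := by ext; simp [shapiroCochain]
      map_smul' a f := by ext; simp [shapiroCochain] }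
  comm' n m hnm := by
    obtain rfl : n + 1 = m := hnm
    ext f : 2
    simpa using! d_shapiroCochain hσ f

/-- The evaluation `coind A → A` at `1`, as a morphism of representations of `C`. -/
def coindEval (φ : C →* Q) (A : Rep.{u} k C) : Rep.res φ (Rep.coind φ A) ⟶ A := Rep.ofHom
  { LinearMap.proj 1 ∘ₗ Submodule.subtype (Representation.coindV φ A.ρ) with
    isIntertwining' c := by
      ext a
      simpa [-Representation.coind_apply, coe_coind_apply] using a.2 c 1 }

theorem shapiroMap_comp_cochainsMap_coindEval (hσ_one : σ 1 = 1) :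
    shapiroMap hσ ≫ groupCohomology.cochainsMap φ (coindEval φ A) =
      𝟙 (groupCohomology.inhomogeneousCochains A) := by
  ext n f g
  refine Eq.trans ?_ (congrArg f (partialProd_injective (funext fun i => ?_) :
    shapiroTuple σ 1 (φ ∘ g) = g))
  · exact (congrArg (fun c => A.ρ c (f (shapiroTuple σ 1 (φ ∘ g)))) hσ_one).trans (by simp)
  · rw [partialProd_shapiroTuple, one_mul, hσ_one, inv_one, one_mul, ← map_partialProd]
    simpa [hσ_one] using hσ (Fin.partialProd g i) 1

end Shapiro

section Inflation

open Limits

variable {k Γ Q : Type u} [CommRing k] [Group Γ] [TopologicalSpace Γ] [Group Q]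
  [TopologicalSpace Q] [DiscreteTopology Q] {π : Γ →* Q}

theorem isDiscreteModule_res (hπ : Continuous π) (A : Rep.{u} k Q) :
    IsDiscreteModule (Rep.res π A) := fun a =>
  (IsLocallyConstant.of_discrete fun q => A.ρ q a).comp_continuous hπ

variable [IsTopologicalGroup Γ]

/-- The inflation map from the cochains of a discrete quotient to continuous cochains. -/
def inflation (hπ : Continuous π) (A : Rep.{u} k Q) :
    groupCohomology.inhomogeneousCochains A ⟶
      contCochainComplex (Rep.res π A) (isDiscreteModule_res hπ A) where
  f n := ModuleCat.ofHom <|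
    (LinearMap.funLeft k A fun g : Fin n → Γ => π ∘ g).codRestrict (contCochains (Rep.res π A) n)
      fun f => (IsLocallyConstant.of_discrete f).comp_continuous (by fun_prop)
  comm' n m hnm := by
    obtain rfl : n + 1 = m := hnm
    simp only [contCochainComplex, CochainComplex.of_d]
    refine ModuleCat.hom_ext (LinearMap.ext fun f => Subtype.ext ?_)
    have hcomm := (groupCohomology.cochainsMap π (𝟙 (Rep.res π A))).comm n (n + 1)
    simp only [CochainComplex.of_d] at hcomm
    exact congrArg (fun φ => φ.hom f) hcomm

theorem inflation_comp_contCochainsIncl (hπ : Continuous π) (A : Rep.{u} k Q) :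
    inflation hπ A ≫ contCochainsIncl _ _ = groupCohomology.cochainsMap π (𝟙 (Rep.res π A)) := rfl

/-- By Shapiro's lemma, `Hⁿ(C, A)` is a direct summand of `Hⁿ(Γ, M)`, where `M` is the `Γ`-module
coinduced from the image of `C` in `Q`. -/
theorem isZero_groupCohomology_of_contCohomology_coind {C : Type u} [Group C] {τ : C →* Γ}
    (hτ : Function.Injective (π.comp τ)) (hπ : Continuous π) (A : Rep.{u} k C) {n : ℕ}
    (h : IsZero (contCohomology _ (isDiscreteModule_res hπ (Rep.coind (π.comp τ) A)) n)) :
    IsZero (groupCohomology A n) := by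
  obtain ⟨σ, hσ, hσ_one⟩ := exists_equivariant_of_injective hτ
  let r : Retract (groupCohomology.inhomogeneousCochains A) (contCochainComplex _
      (isDiscreteModule_res hπ (Rep.coind (π.comp τ) A))) :=
    { i := shapiroMap hσ ≫ inflation hπ _
      r := contCochainsIncl _ _ ≫ groupCohomology.cochainsMap τ (coindEval (π.comp τ) A)
      retract := by
        rw [Category.assoc, ← Category.assoc (inflation hπ _), inflation_comp_contCochainsIncl]
        exact shapiroMap_comp_cochainsMap_coindEval hσ hσ_one }
  exact isZero_of_retract (r.map (HomologicalComplex.homologyFunctor _ _ n)) h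

end Inflation

section Preimage

open Limits

variable {k G C Q : Type u} [CommRing k] [Group G] [Group C] [Group Q] (θ : G →* Q) {φ : C →* Q}
  (hφ : Function.Injective φ)

/-- The projection to `C` of the preimage of `φ(C)` under `θ`, i.e. of the fibre product of `G` and
`C` over `Q`. -/
def preimageProj : φ.range.comap θ →* C :=
  (MonoidHom.ofInjective hφ).symm.toMonoidHom.comp (θ.subgroupComap φ.range)

theorem map_preimageProj (h : φ.range.comap θ) : φ (preimageProj θ hφ h) = θ h :=
  MonoidHom.apply_ofInjective_symm hφ _

variable {θ}

theorem isZero_groupCohomology_res_coind (hθ : Function.Surjective θ) {A : Rep.{u} k C} {n : ℕ}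
    (h : IsZero (groupCohomology (Rep.res (preimageProj θ hφ) A) n)) :
    IsZero (groupCohomology (Rep.res θ (Rep.coind φ A)) n) := by
  let B := Rep.res (preimageProj θ hφ) A
  have coind_eq (b : Representation.coindV (φ.range.comap θ).subtype B.ρ) {c : C} {g g' : G}
      (hg : θ g = φ c * θ g') : b.1 g = A.ρ c (b.1 g') := by
    have hmem : θ (g * g'⁻¹) = φ c := by rw [map_mul, map_inv, hg, mul_inv_cancel_right]
    let x : φ.range.comap θ := ⟨g * g'⁻¹, c, hmem.symm⟩
    have hx : preimageProj θ hφ x = c := hφ ((map_preimageProj θ hφ x).trans hmem)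
    simpa [B, x, hx] using b.2 x g'
  choose s hs using hθ
  let r : Retract (Rep.res θ (Rep.coind φ A)) (Rep.coind (φ.range.comap θ).subtype B) :=
    { i := Rep.ofHom
        { toFun a := ⟨fun g => a.1 (θ g), fun x g => by
            have := a.2 (preimageProj θ hφ x) (θ g)
            simpa [B, map_preimageProj] using this⟩
          map_add' _ _ := rfl
          map_smul' _ _ := rfl
          isIntertwining' g := by
            ext a x
            simp [-Representation.coind_apply, coe_coind_apply] }
      r := Rep.ofHom
        { toFun b := ⟨fun q => b.1 (s q), fun c q => coind_eq b (by simp [hs])⟩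
          map_add' _ _ := rfl
          map_smul' _ _ := rfl
          isIntertwining' g := by
            ext b q
            simpa [-Representation.coind_apply, coe_coind_apply] using
              coind_eq b (c := 1) (g := s q * g) (g' := s (q * θ g)) (by simp [hs]) }
      retract := by
        ext a q
        simp [hs] }
  exact isZero_groupCohomology_of_retract r (h.of_iso (groupCohomology.coindIso B n))

end Preimage

section Cyclic

open Limits

theorem not_isZero_groupCohomology_of_cyclic {k C : Type u} [CommRing k] [Group C] [IsCyclic C]
    [Finite C] {W : Type u} [AddCommGroup W] [Module k W] [Nontrivial W]
    (hW : ∀ w : W, Nat.card C • w = 0) {n : ℕ} (hn : n ≠ 0) (hn' : Even n) :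
    ¬ IsZero (groupCohomology (Rep.trivial k C W) n) := by
  intro h
  let _ : CommGroup C := IsCyclic.commGroup
  have := Fintype.ofFinite C
  have : NeZero n := ⟨hn⟩
  obtain ⟨c, hc⟩ := IsCyclic.exists_generator (α := C)
  obtain ⟨w, hw⟩ := exists_ne (0 : W)
  have hsub := ModuleCat.subsingleton_of_isZero h
  let A := Rep.trivial k C W
  let x : LinearMap.ker (A.applyAsHom c - 𝟙 A).hom.toLinearMap := ⟨w, sub_self w⟩
  obtain ⟨v, hv⟩ := (Rep.FiniteCyclicGroup.groupCohomologyπEven_eq_zero_iff A c hc n hn' x).1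
    (Subsingleton.elim _ _)
  have norm_eq : A.norm.hom v = Nat.card C • v := by
    simp [A, Rep.norm, Representation.norm]
  exact hw (hv.symm.trans (norm_eq.trans (hW v)))

end Cyclic

section FiniteCoefficients

open Limits

theorem injective_comp_subtype_zpowers {Γ Q : Type*} [Group Γ] [Group Q] {π : Γ →* Q} {γ : Γ}
    (hγ : (orderOf γ).Prime) (hγπ : π γ ≠ 1) :
    Function.Injective (π.comp (Subgroup.zpowers γ).subtype) := by
  refine (injective_iff_map_eq_one _).2 fun c hc => ?_
  by_contra hne
  have := Fact.mk hγ
  obtain ⟨m, hm⟩ := mem_zpowers_of_prime_card (g' := ⟨γ, Subgroup.mem_zpowers γ⟩)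
    (Nat.card_zpowers γ) hne
  refine hγπ ((congrArg (π.comp (Subgroup.zpowers γ).subtype) hm).symm.trans ?_)
  simp only [map_zpow, hc, one_zpow]

variable {k G Γ Q : Type u} [CommRing k] [Group G] [Group Γ] [TopologicalSpace Γ]
  [IsTopologicalGroup Γ] [Group Q]

variable (k) in
/-- The condition on `ι : G → Γ` which for `Γ = Ĝ` is cohomological goodness of `G`. -/
def IsFiniteCohomologyIso (ι : G →* Γ) : Prop :=
  ∀ (M : Rep.{u} k Γ) (hM : IsDiscreteModule M), Finite M →
    ∀ n : ℕ, IsIso (contCohomologyRes ι M hM n)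

variable [Finite Q] [TopologicalSpace Q] [DiscreteTopology Q] {ι : G →* Γ} {π : Γ →* Q}
  {W : Type u} [AddCommGroup W] [Module k W] [Finite W] [Nontrivial W]

theorem not_isEventuallyAcyclic_preimage (hι : IsFiniteCohomologyIso k ι) (hπ : Continuous π)
    (hθ : Function.Surjective (π.comp ι)) {C : Type u} [Group C] [IsCyclic C] [Finite C]
    {τ : C →* Γ} (hτ : Function.Injective (π.comp τ)) (hW : ∀ w : W, Nat.card C • w = 0) :
    ¬ IsEventuallyAcyclic (Rep.trivial k ((π.comp τ).range.comap (π.comp ι)) W) := by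
  intro h
  obtain ⟨n₀, hn₀⟩ := Filter.eventually_atTop.1 h
  let n := 2 * n₀ + 2
  have hM := isDiscreteModule_res hπ (Rep.coind (π.comp τ) (Rep.trivial k C W))
  have hG : IsZero (groupCohomology
      (Rep.res (π.comp ι) (Rep.coind (π.comp τ) (Rep.trivial k C W))) n) :=
    isZero_groupCohomology_res_coind hτ hθ (hn₀ n (by lia))
  have := hι _ hM (inferInstanceAs (Finite (Representation.coindV _ _))) n
  have hΓ := hG.of_iso (asIso (contCohomologyRes ι _ hM n))
  exact not_isZero_groupCohomology_of_cyclic hW (Nat.succ_ne_zero _) (n := n) ⟨n₀ + 1, by lia⟩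
    (isZero_groupCohomology_of_contCohomology_coind hτ hπ _ hΓ)

theorem exists_orderOf_eq_of_mem_zpowers (hι : IsFiniteCohomologyIso k ι) (hπ : Continuous π)
    (hθ : Function.Surjective (π.comp ι)) {n : ℕ}
    (hker : HasProjectiveDimensionLT (Rep.trivial k (π.comp ι).ker k) (n + 1)) {γ : Γ}
    (hγ : (orderOf γ).Prime) (hγπ : π γ ≠ 1) (hW : ∀ w : W, orderOf γ • w = 0) :
    ∃ g : G, orderOf g = orderOf γ ∧ π (ι g) ∈ Subgroup.zpowers (π γ) := by
  have := Fact.mk hγ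
  let τ := (Subgroup.zpowers γ).subtype
  have card_zpowers := Nat.card_zpowers γ
  have : Finite (Subgroup.zpowers γ) := Nat.finite_of_card_ne_zero (card_zpowers ▸ hγ.ne_zero)
  have hτ : Function.Injective (π.comp τ) := injective_comp_subtype_zpowers hγ hγπ
  let ψ := preimageProj (π.comp ι) hτ
  have hψ : Function.Surjective ψ := fun c => by
    obtain ⟨g, hg⟩ := hθ (π c)
    exact ⟨⟨g, c, hg.symm⟩, hτ ((map_preimageProj _ hτ _).trans hg)⟩
  have index_ker : ψ.ker.index = orderOf γ := by
    rw [Subgroup.index_ker, MonoidHom.range_eq_top.2 hψ, Subgroup.card_top, card_zpowers]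
  have ker_le (u : ψ.ker) : (u.1.1 : G) ∈ (π.comp ι).ker :=
    (map_preimageProj _ hτ u.1).symm.trans ((congrArg _ u.2).trans (map_one _))
  have hU : HasProjectiveDimensionLT (Rep.trivial k ψ.ker k) (n + 1) :=
    hasProjectiveDimensionLT_res_of_injective (f := ((Subgroup.subtype _).comp
      (Subgroup.subtype _)).codRestrict _ ker_le) (fun a b hab => Subtype.ext (Subtype.ext
        (congrArg Subtype.val hab :))) hker
  by_contra! hcon
  refine not_isEventuallyAcyclic_preimage hι hπ hθ hτ (card_zpowers ▸ hW)
    (isEventuallyAcyclic_of_index_prime hU (index_ker ▸ hγ) (fun h hh => ?_) (index_ker ▸ hW))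
  by_contra hne
  obtain ⟨⟨_, m, rfl⟩, hm⟩ := h.2
  refine hcon h ?_ ⟨m, (map_zpow π γ m).symm.trans hm⟩
  rw [Subgroup.orderOf_coe, orderOf_eq_prime (index_ker ▸ hh) hne]

theorem exists_orderOf_eq_map_eq (hι : IsFiniteCohomologyIso k ι) (hπ : Continuous π)
    (hθ : Function.Surjective (π.comp ι)) {n : ℕ}
    (hker : HasProjectiveDimensionLT (Rep.trivial k (π.comp ι).ker k) (n + 1)) {γ : Γ}
    (hγ : (orderOf γ).Prime) (hγπ : π γ ≠ 1) (hG : ∀ g : G, orderOf g = orderOf γ → π (ι g) ≠ 1)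
    (hW : ∀ w : W, orderOf γ • w = 0) : ∃ g : G, orderOf g = orderOf γ ∧ π (ι g) = π γ := by
  have := Fact.mk hγ
  obtain ⟨g, hg, hgγ⟩ := exists_orderOf_eq_of_mem_zpowers hι hπ hθ hker hγ hγπ hW
  have hord : orderOf (π γ) = orderOf γ :=
    orderOf_eq_prime (by rw [← map_pow, pow_orderOf_eq_one, map_one]) hγπ
  obtain ⟨m, hm⟩ := mem_zpowers_of_prime_card (g := (⟨_, hgγ⟩ : Subgroup.zpowers (π γ)))
    (g' := ⟨π γ, Subgroup.mem_zpowers _⟩) ((Nat.card_zpowers _).trans hord)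
    fun h => hG g hg (congrArg Subtype.val h)
  have hm' : π (ι (g ^ m)) = π γ := by
    rw [map_zpow, map_zpow]
    exact congrArg Subtype.val hm
  refine ⟨g ^ m, orderOf_eq_prime ?_ fun h => hγπ ?_, hm'⟩
  · rw [← zpow_natCast, zpow_comm, zpow_natCast, ← hg, pow_orderOf_eq_one, one_zpow]
  · rw [← hm', h, map_one, map_one]

end FiniteCoefficients

section ConjugacyClasses

variable {G : Type u} [Group G] {p : ℕ}

open scoped Pointwise

theorem conjAct_smul_zpowers (a : ConjAct G) (g : G) :
    a • Subgroup.zpowers g = Subgroup.zpowers (a • g) :=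
  MonoidHom.map_zpowers (MulDistribMulAction.toMonoidEnd (ConjAct G) G a) g

theorem conjClasses_mk_conjAct_smul (a : ConjAct G) (g : G) :
    ConjClasses.mk (a • g) = ConjClasses.mk g :=
  ConjClasses.mk_eq_mk_iff_isConj.2 (isConj_comm.1 (isConj_iff.2 ⟨ConjAct.ofConjAct a, rfl⟩))

theorem exists_zpowers_eq_of_prime_card (hp : p.Prime) {P : Subgroup G} (hP : Nat.card P = p) :
    ∃ x : G, Subgroup.zpowers x = P := by
  have := Fact.mk hp
  have := isCyclic_of_prime_card hP
  exact P.isCyclic_iff_exists_zpowers_eq_top.1 this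

theorem isConj_out_mk (g : G) : IsConj g (ConjClasses.mk g).out :=
  ConjClasses.mk_eq_mk_iff_isConj.1 (Quotient.out_eq _).symm

theorem finite_elementClassesOfOrder (hp : p ≠ 0) (h : (subgroupClassesOfOrder G p).Finite) :
    (elementClassesOfOrder G p).Finite := by
  obtain ⟨T, hTp, hT⟩ := Set.exists_subset_bijOn {P : Subgroup G | Nat.card P = p} fun P =>
    (Quotient.mk'' P : MulAction.orbitRel.Quotient (ConjAct G) (Subgroup G))
  have finite_biUnion : (⋃ P ∈ T, ConjClasses.mk '' (P : Set G)).Finite :=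
    (hT.finite_iff_finite.2 h).biUnion fun P hP =>
      have : Finite P := Nat.finite_of_card_ne_zero (hTp hP ▸ hp)
      (Set.toFinite (P : Set G)).image _
  refine finite_biUnion.subset ?_
  rintro _ ⟨g, hg, rfl⟩
  obtain ⟨P, hP, hPg⟩ := hT.surjOn ⟨Subgroup.zpowers g, (Nat.card_zpowers g).trans hg, rfl⟩
  obtain ⟨a, rfl⟩ := MulAction.orbitRel_apply.1 (Quotient.eq''.1 hPg)
  refine Set.mem_biUnion hP ⟨a • g, ?_, conjClasses_mk_conjAct_smul a g⟩
  exact (conjAct_smul_zpowers a g).ge (Subgroup.mem_zpowers (a • g))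

theorem finite_subgroupClassesOfOrder (hp : p.Prime) (h : (elementClassesOfOrder G p).Finite) :
    (subgroupClassesOfOrder G p).Finite := by
  refine (h.image fun c => (Quotient.mk'' (Subgroup.zpowers c.out) :
    MulAction.orbitRel.Quotient (ConjAct G) (Subgroup G))).subset ?_
  rintro _ ⟨P, hP, rfl⟩
  obtain ⟨x, rfl⟩ := exists_zpowers_eq_of_prime_card hp hP
  refine ⟨ConjClasses.mk x, ⟨x, (Nat.card_zpowers x).symm.trans hP, rfl⟩, ?_⟩
  obtain ⟨a, ha⟩ := isConj_iff.1 (isConj_out_mk x)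
  refine Quotient.eq''.2 (MulAction.orbitRel_apply.2 ⟨ConjAct.toConjAct a, ?_⟩)
  exact (conjAct_smul_zpowers _ x).trans (congrArg _ ha)

end ConjugacyClasses

section ProfiniteCompletion

open scoped Topology

theorem isClosed_setOf_isConj {Γ : Type*} [Group Γ] [TopologicalSpace Γ] [IsTopologicalGroup Γ]
    [CompactSpace Γ] [T2Space Γ] (a : Γ) : IsClosed {x | IsConj x a} := by
  have range_eq : Set.range (fun y : Γ => y * a * y⁻¹) = {x | IsConj x a} := by
    ext x
    rw [Set.mem_ofPred_eq, isConj_comm, isConj_iff, Set.mem_range]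
  exact range_eq ▸ (isCompact_range (by fun_prop)).isClosed

variable {G : Type u} [Group G]

theorem isClosed_setOf_isConj_toProfComp {p : ℕ} (h : (elementClassesOfOrder G p).Finite) :
    IsClosed {x : ProfComp G | ∃ g : G, orderOf g = p ∧ IsConj x (toProfComp G g)} := by
  convert h.isClosed_biUnion fun c _ => isClosed_setOf_isConj (toProfComp G c.out)
  ext x
  simp only [elementClassesOfOrder, Set.mem_ofPred_eq, Set.biUnion_image, Set.mem_iUnion,
    exists_prop]
  refine exists_congr fun g => and_congr_right fun _ => ?_
  have hg := (toProfComp G).map_isConj (isConj_out_mk g)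
  exact ⟨fun hx => hx.trans hg, fun hx => hx.trans hg.symm⟩

theorem surjective_comp_toProfComp {Q : Type*} [Group Q] [TopologicalSpace Q] [DiscreteTopology Q]
    {π : ProfComp G →* Q} (hπ : Continuous π) (hsurj : Function.Surjective π) :
    Function.Surjective (π.comp (toProfComp G)) := by
  have dense : DenseRange (π ∘ toProfComp G) :=
    hsurj.denseRange.comp (ProfiniteGrp.ProfiniteCompletion.denseRange (GrpCat.of G)) hπ
  exact Set.range_eq_univ.1 (dense_discrete.1 dense)

theorem exists_mem_nhds_one_preimage_toProfComp_subset (U : Subgroup G) [U.FiniteIndex] :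
    ∃ s ∈ 𝓝 (1 : ProfComp G), toProfComp G ⁻¹' s ⊆ U := by
  let m : FiniteIndexNormalSubgroup (GrpCat.of G) := { toSubgroup := U.normalCore }
  have : DiscreteTopology ((ProfiniteGrp.ProfiniteCompletion.diagram (GrpCat.of G)).obj m) := ⟨rfl⟩
  have isOpen_ker : IsOpen {x : ProfComp G | x.val m = 1} :=
    (isOpen_discrete {1}).preimage ((continuous_apply m).comp continuous_subtype_val)
  exact ⟨_, isOpen_ker.mem_nhds rfl, fun g hg =>
    U.normalCore_le ((QuotientGroup.eq_one_iff g).1 hg)⟩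

theorem exists_openNormalSubgroup_comap_le (U : Subgroup G) [U.FiniteIndex] {γ : ProfComp G}
    {s : Set (ProfComp G)} (hs : s ∈ 𝓝 γ) :
    ∃ V : OpenNormalSubgroup (ProfComp G),
      V.toSubgroup.comap (toProfComp G) ≤ U ∧ ∀ v ∈ V, γ * v ∈ s := by
  obtain ⟨t, ht, htU⟩ := exists_mem_nhds_one_preimage_toProfComp_subset U
  have hγs : (γ * ·) ⁻¹' s ∈ 𝓝 (1 : ProfComp G) :=
    (continuous_const_mul γ).continuousAt (by rwa [mul_one])
  obtain ⟨o, ho, isOpen_o, one_mem⟩ := mem_nhds_iff.1 (Filter.inter_mem ht hγs)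
  obtain ⟨V, hV⟩ := ProfiniteGrp.exist_openNormalSubgroup_sub_open_nhds_of_one isOpen_o one_mem
  exact ⟨V, fun g hg => htU (ho (hV hg)).1, fun v hv => (ho (hV hv)).2⟩

theorem exists_torsionFree_of_vcd_lt_top (h : vcd G < ⊤) :
    ∃ U : Subgroup G, U.FiniteIndex ∧ (∀ u : U, IsOfFinOrder u → u = 1) ∧
      ∃ n, HasProjectiveDimensionLT (Rep.trivial IntU.{u} U IntU.{u}) (n + 1) := by
  obtain ⟨U, hU⟩ := iInf_lt_iff.1 h
  obtain ⟨hindex, hU⟩ := iInf_lt_iff.1 hU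
  obtain ⟨htf, hU⟩ := iInf_lt_iff.1 hU
  exact ⟨U, hindex, htf, (projectiveDimension_ne_top_iff _).1 hU.ne⟩

theorem exists_orderOf_eq_of_notMem (hgood : IsCohomologicallyGood G) {U : Subgroup G}
    (htf : ∀ u : U, IsOfFinOrder u → u = 1) {n : ℕ}
    (hU : HasProjectiveDimensionLT (Rep.trivial IntU.{u} U IntU.{u}) (n + 1))
    (V : OpenNormalSubgroup (ProfComp G)) (hVU : V.toSubgroup.comap (toProfComp G) ≤ U)
    {γ : ProfComp G} (hγ : (orderOf γ).Prime) (hγV : γ ∉ V) :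
    ∃ g : G, orderOf g = orderOf γ ∧ γ⁻¹ * toProfComp G g ∈ V := by
  have := Fact.mk hγ
  have : DiscreteTopology (ProfComp G ⧸ V.toSubgroup) := QuotientGroup.discreteTopology V.isOpen'
  have : Finite (ProfComp G ⧸ V.toSubgroup) := Subgroup.quotient_finite_of_isOpen _ V.isOpen'
  have hπ : Continuous (QuotientGroup.mk' V.toSubgroup) := QuotientGroup.continuous_mk
  have ker_le : ((QuotientGroup.mk' V.toSubgroup).comp (toProfComp G)).ker ≤ U := by
    rwa [← MonoidHom.comap_ker, QuotientGroup.ker_mk']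
  let _ : Module IntU.{u} (ULift.{u} (ZMod (orderOf γ))) :=
    Module.compHom _ (ULift.ringEquiv : ULift.{u} ℤ ≃+* ℤ).toRingHom
  obtain ⟨g, hg, hgγ⟩ := exists_orderOf_eq_map_eq (W := ULift.{u} (ZMod (orderOf γ))) hgood hπ
    (surjective_comp_toProfComp hπ (QuotientGroup.mk'_surjective _))
    (hasProjectiveDimensionLT_res_of_injective (Subgroup.inclusion_injective ker_le) hU) hγ
    (fun h => hγV ((QuotientGroup.eq_one_iff γ).1 h))
    (fun g hg h => by
      have hgU : IsOfFinOrder (⟨g, ker_le h⟩ : U) :=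
        Submonoid.isOfFinOrder_coe.1 (orderOf_pos_iff.1 (hg ▸ hγ.pos))
      have hg1 : g = 1 := congrArg Subtype.val (htf _ hgU)
      exact hγ.one_lt.ne (by rw [← hg, hg1, orderOf_one]))
    (fun w => ULift.ext _ _ (by simp))
  exact ⟨g, hg, QuotientGroup.eq.1 hgγ.symm⟩

theorem mem_closure_toProfComp_orderOf_eq (hgood : IsCohomologicallyGood G) (hvcd : vcd G < ⊤)
    {γ : ProfComp G} (hγ : (orderOf γ).Prime) :
    γ ∈ closure (toProfComp G '' {g | orderOf g = orderOf γ}) := by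
  refine mem_closure_iff_nhds.2 fun s hs => ?_
  obtain ⟨U, hindex, htf, n, hU⟩ := exists_torsionFree_of_vcd_lt_top hvcd
  have γ_ne_one : γ ≠ 1 := fun h => hγ.one_lt.ne (h ▸ orderOf_one.symm)
  obtain ⟨V, hVU, hV⟩ := exists_openNormalSubgroup_comap_le U
    (Filter.inter_mem hs (isOpen_compl_singleton.mem_nhds γ_ne_one))
  have hγV : γ ∉ V := fun h => (hV _ (V.inv_mem h)).2 (mul_inv_cancel γ)
  obtain ⟨g, hg, hgV⟩ := exists_orderOf_eq_of_notMem hgood htf hU V hVU hγ hγV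
  exact ⟨toProfComp G g, by simpa only [mul_inv_cancel_left] using (hV _ hgV).1, g, hg, rfl⟩

theorem exists_isConj_toProfComp (hgood : IsCohomologicallyGood G) (hvcd : vcd G < ⊤)
    {γ : ProfComp G} (hγ : (orderOf γ).Prime)
    (hfin : (elementClassesOfOrder G (orderOf γ)).Finite) : ∃ g : G, IsConj γ (toProfComp G g) := by
  have image_subset : toProfComp G '' {g | orderOf g = orderOf γ} ⊆
      {x | ∃ g : G, orderOf g = orderOf γ ∧ IsConj x (toProfComp G g)} := by
    rintro _ ⟨g, hg, rfl⟩
    exact ⟨g, hg, IsConj.refl _⟩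
  obtain ⟨g, -, hg⟩ := closure_minimal image_subset (isClosed_setOf_isConj_toProfComp hfin)
    (mem_closure_toProfComp_orderOf_eq hgood hvcd hγ)
  exact ⟨g, hg⟩

end ProfiniteCompletion

end

theorem proposition3p4_general (p : ℕ) (hp : p.Prime) (G : Type u) [Group G]
    (hgood : IsCohomologicallyGood G) (hvcd : vcd G < ⊤) :
    ((subgroupClassesOfOrder G p).Finite ↔ (elementClassesOfOrder G p).Finite) ∧
      ((subgroupClassesOfOrder G p).Finite →
        ∀ γ : ProfComp G, orderOf γ = p → ∃ g : G, IsConj γ (toProfComp G g)) := by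
  refine ⟨⟨finite_elementClassesOfOrder hp.ne_zero, finite_subgroupClassesOfOrder hp⟩, ?_⟩
  rintro h γ rfl
  exact exists_isConj_toProfComp hgood hvcd hp (finite_elementClassesOfOrder hp.ne_zero h)

theorem proposition3p4 (p : ℕ) (hp : p.Prime) (G : Type u) [Group G]
    (hres : Group.ResiduallyFinite G) (hgood : IsCohomologicallyGood G) (hvcd : vcd G < ⊤) :
    ((subgroupClassesOfOrder G p).Finite ↔ (elementClassesOfOrder G p).Finite) ∧
      ((subgroupClassesOfOrder G p).Finite →
        ∀ γ : ProfComp G, orderOf γ = p → ∃ g : G, IsConj γ (toProfComp G g)) :=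
  proposition3p4_general p hp G hgood hvcd
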